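/- Let $L,m\ge 1$ and, for each $l=1,\dots,L$, let $\mathcal{E}^l=\{\eta_i^l,\rho_i^l\}_{i=1}^{n_l}$ be an ensemble of quantum states (density operators) on an $m$-party space $\bigotimes_{k=1}^m\mathbb{C}^{d_{l,k}}$ with probabilities $\eta_i^l>0$, $\sum_i\eta_i^l=1$. Let $$\bigotimes_{l=1}^L\mathcal{E}^l=\{\eta_{\vec c},\rho_{\vec c}\}_{\vec c},\qquad \eta_{\vec c}=\prod_{l=1}^L\eta^l_{c_l},\qquad \rho_{\vec c}=\bigotimes_{l=1}^L\rho^l_{c_l},\qquad \vec c=(c_1,\dots,c_L),\ 1\le c_l\le n_l,$$ be the sequence ensemble, regarded as an ensemble of $m$-party states in which party $k$ holds $\bigotimes_{l}\mathbb{C}^{d_{l,k}}$. For an ensemble $\mathcal{E}=\{\eta_i,\rho_i\}_i$, let $p_{\sf G}(\mathcal{E})$ be the maximum of $\sum_i\eta_i\operatorname{Tr}(\rho_iM_i)$ over all measurements $\{M_i\}_i$ ($M_i\ge 0$, $\sum_iM_i=\mathbb{1}$), and let $p_{\sf L}(\mathcal{E})$ be the supremum of the same quantity over all measurements that can be realized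 by local operations and classical communication (LOCC) among the $m$ parties, that is, by finitely many rounds in each of which one party performs a quantum instrument on its system and broadcasts the outcome, the other parties apply local channels, and all later operations, as well as the final guess, may depend on the outcomes broadcast so far. Assume that the optimal LOCC discrimination of $\bigotimes_l\mathcal{E}^l$ is factorizable, that is, $$p_{\sf L}\Big(\bigotimes_{l=1}^L\mathcal{E}^l\Big)=\prod_{l=1}^Lp_{\sf L}(\mathcal{E}^l).$$ Then $$\max_{\vec c}\eta_{\vec c}<p_{\sf L}\Big(\bigotimes_{l=1}^L\mathcal{E}^l\Big)<p_{\sf G}\Big(\bigotimes_{l=1}^L\mathcal{E}^l\Big)$$ holds if and only if there exist $l,l'\in\{1,\dots,L\}$ such that $$\max_{1\le i\le n_l}\eta_i^l<p_{\sf L}(\mathcal{E}^l)\qquad\text{and}\qquad p_{\sf L}(\mathcal{E}^{l'})<p_{\sf G}(\mathcal{E}^{l'}).$$ -/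

import Mathlib

open scoped Matrix ComplexOrder

namespace QuantumSequence

/-- Operators on the `m`-party space `⨂ₖ ℂ^{D k}`, as matrices in the product basis. -/
abbrev Op {m : ℕ} (D : Fin m → Type) : Type :=
  Matrix (∀ k, D k) (∀ k, D k) ℂ

/-- The product operator `⨂ₖ B k : ⨂ₖ ℂ^{D k} → ⨂ₖ ℂ^{D' k}`. -/
def tensorOp {m : ℕ} {D D' : Fin m → Type} (B : ∀ k, Matrix (D' k) (D k) ℂ) :
    Matrix (∀ k, D' k) (∀ k, D k) ℂ :=
  fun a b => ∏ k, B k (a k) (b k)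

/-- For operators `ρ l` on the `m`-party spaces `⨂ₖ ℂ^{D l k}`, the operator `⨂ₗ ρ l`, regarded as
an operator on an `m`-party space in which party `k` holds `⨂ₗ ℂ^{D l k}`. -/
def seqOp {L m : ℕ} {D : Fin L → Fin m → Type} (ρ : ∀ l, Op (D l)) :
    Op (fun k => ∀ l, D l k) :=
  fun a b => ∏ l, ρ l (fun k => a k l) (fun k => b k l)

/-- An ensemble of `m`-party quantum states with nonzero preparation probabilities. -/
structure Ensemble {m : ℕ} (D : Fin m → Type) [∀ k, Fintype (D k)] (ι : Type) [Fintype ι] where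
  prob : ι → ℝ
  state : ι → Op D
  prob_pos : ∀ i, 0 < prob i
  prob_sum : ∑ i, prob i = 1
  state_posSemidef : ∀ i, (state i).PosSemidef
  state_trace : ∀ i, (state i).trace = 1

/-- A measurement with outcomes in `ι`. -/
structure IsMeasurement {m : ℕ} {D : Fin m → Type} [∀ k, Fintype (D k)] [∀ k, DecidableEq (D k)]
    {ι : Type} [Fintype ι] (M : ι → Op D) : Prop where
  posSemidef : ∀ i, (M i).PosSemidef
  sum_eq_one : ∑ i, M i = 1

/-- `M` is the family of effects of an LOCC protocol with `r` rounds of communication.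

With no round left, the parties announce a guess `i` fixed by the transcript so far.  In a round,
some party `k` performs a quantum instrument and broadcasts its outcome `x`; each other party `j`
then applies a trace-preserving completely positive map that may depend on `x`; and the parties
continue with an LOCC protocol `N x` that may depend on `x`.  All maps are given by Kraus operators
`B x j s`, and the dimensions `e x j` of the local spaces after the round are arbitrary. -/
def IsLOCCRounds {m : ℕ} {ι : Type} [DecidableEq ι] :
    ℕ → ∀ (D : Fin m → Type) [∀ k, Fintype (D k)] [∀ k, DecidableEq (D k)], (ι → Op D) → Prop
  | 0, _, _, _, M => ∃ i, M = Pi.single i 1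
  | r + 1, D, _, _, M =>
      ∃ (k : Fin m) (q : ℕ) (e t : Fin q → Fin m → ℕ)
        (B : ∀ x j, Fin (t x j) → Matrix (Fin (e x j)) (D j) ℂ)
        (N : ∀ x, ι → Op (fun j => Fin (e x j))),
        (∑ x, ∑ s, (B x k s)ᴴ * B x k s = 1) ∧
        (∀ x, ∀ j, j ≠ k → ∑ s, (B x j s)ᴴ * B x j s = 1) ∧
        (∀ x, IsLOCCRounds r (fun j => Fin (e x j)) (N x)) ∧
        ∀ i, M i = ∑ x, ∑ s : (∀ j, Fin (t x j)),
          (tensorOp fun j => B x j (s j))ᴴ * N x i * tensorOp fun j => B x j (s j)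

/-- A measurement that can be realized by LOCC (with finitely many rounds). -/
def IsLOCCMeasurement {m : ℕ} {D : Fin m → Type} [∀ k, Fintype (D k)] [∀ k, DecidableEq (D k)]
    {ι : Type} [Fintype ι] [DecidableEq ι] (M : ι → Op D) : Prop :=
  IsMeasurement M ∧ ∃ r, IsLOCCRounds r D M

section Discrimination

variable {m : ℕ} {D : Fin m → Type} [∀ k, Fintype (D k)] [∀ k, DecidableEq (D k)]
  {ι : Type} [Fintype ι] [DecidableEq ι]

/-- The average probability of guessing the prepared state correctly with `M`. -/
noncomputable def Ensemble.success (E : Ensemble D ι) (M : ι → Op D) : ℝ :=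
  ∑ i, E.prob i * (E.state i * M i).trace.re

/-- The optimal success probability over all measurements. -/
noncomputable def Ensemble.pG (E : Ensemble D ι) : ℝ :=
  sSup {p | ∃ M : ι → Op D, IsMeasurement M ∧ p = E.success M}

/-- The optimal success probability over all LOCC measurements.  The set of LOCC measurements need
not be closed, so this is a supremum; since the success probability is continuous in the
measurement, adding limits of finite-round protocols would not change its value. -/
noncomputable def Ensemble.pL (E : Ensemble D ι) : ℝ :=
  sSup {p | ∃ M : ι → Op D, IsLOCCMeasurement M ∧ p = E.success M}

end Discrimination

section Factor

open scoped MatrixOrder Matrix.Norms.L2Operator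

theorem exists_eq_conjTranspose_mul_self {n : Type} [Fintype n] {A : Matrix n n ℂ}
    (hA : A.PosSemidef) : ∃ B : Matrix n n ℂ, A = Bᴴ * B := by
  classical
  exact CStarAlgebra.nonneg_iff_eq_star_mul_self.mp hA.nonneg

end Factor

section Sequence

variable {L m : ℕ} {D : Fin L → Fin m → Type} [∀ l k, Fintype (D l k)]

theorem seqOp_posSemidef {ρ : ∀ l, Op (D l)} (h : ∀ l, (ρ l).PosSemidef) :
    (seqOp ρ).PosSemidef := by
  classical
  choose B hB using fun l => exists_eq_conjTranspose_mul_self (h l)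
  have key : seqOp ρ = (seqOp B)ᴴ * seqOp B := by
    ext a b
    simp only [seqOp, Matrix.mul_apply, Matrix.conjTranspose_apply, star_prod,
      ← Finset.prod_mul_distrib]
    rw [← (Equiv.piComm fun (l : Fin L) (k : Fin m) => D l k).sum_comp]
    simp only [hB, Matrix.mul_apply, Matrix.conjTranspose_apply]
    rw [Finset.prod_univ_sum, Fintype.piFinset_univ]
    rfl
  rw [key]
  exact Matrix.posSemidef_conjTranspose_mul_self _

theorem seqOp_trace (ρ : ∀ l, Op (D l)) : (seqOp ρ).trace = ∏ l, (ρ l).trace := by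
  classical
  simp only [Matrix.trace, Matrix.diag_apply, seqOp]
  rw [← (Equiv.piComm fun (l : Fin L) (k : Fin m) => D l k).sum_comp, Finset.prod_univ_sum,
    Fintype.piFinset_univ]
  rfl

/-- The sequence ensemble `⨂ₗ E l`: the state `⨂ₗ ρ_{c l}` is prepared with probability
`∏ₗ η_{c l}`, and party `k` holds the `k`-th subsystems of all `L` states. -/
def seqEnsemble {n : Fin L → ℕ} (E : ∀ l, Ensemble (D l) (Fin (n l))) :
    Ensemble (fun k => ∀ l, D l k) (∀ l, Fin (n l)) where
  prob c := ∏ l, (E l).prob (c l)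
  state c := seqOp fun l => (E l).state (c l)
  prob_pos c := Finset.prod_pos fun l _ => (E l).prob_pos (c l)
  prob_sum := by
    classical
    have h := Finset.prod_univ_sum (fun l => (Finset.univ : Finset (Fin (n l))))
      fun l i => (E l).prob i
    rw [Fintype.piFinset_univ] at h
    rw [← h]
    exact Finset.prod_eq_one fun l _ => (E l).prob_sum
  state_posSemidef c := seqOp_posSemidef fun l => (E l).state_posSemidef (c l)
  state_trace c := by
    rw [seqOp_trace]
    exact Finset.prod_eq_one fun l _ => (E l).state_trace (c l)

/-- The optimal LOCC discrimination of `⨂ₗ E l` is factorizable. -/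
def IsFactorizable [∀ l k, DecidableEq (D l k)] {n : Fin L → ℕ}
    (E : ∀ l, Ensemble (D l) (Fin (n l))) : Prop :=
  (seqEnsemble E).pL = ∏ l, (E l).pL

end Sequence

end QuantumSequence

/-!
Both strict inequalities compare products of positive numbers ordered factor by factor,
`max η ≤ p_L ≤ p_G`, and such products differ exactly when some factor differs. So the point is that
`p_G` is multiplicative. A tensor product of measurements shows that `p_G` of the sequence is at
least the product. For the converse, `p_G` is the minimal trace of an operator dominating all
`ηᵢ ρᵢ`, and tensor products of such operators dominate the weighted states of the sequence.

That the minimum is attained with value `p_G` comes from a first-order variation. Let `M` be an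
optimal measurement, `P` a projection and `j` an outcome; replacing `Mᵢ` by
`(1 - ε P) Mᵢ (1 - ε P) + δᵢⱼ (1 - (1 - ε P)²)` cannot increase the success probability, and the
terms linear in `ε` say that the Hermitian part of `∑ᵢ ηᵢ ρᵢ Mᵢ` dominates `ηⱼ ρⱼ`.
-/

namespace QuantumSequence

open scoped MatrixOrder

section PositiveMatrices

variable {𝕜 n : Type*} [RCLike 𝕜] [Fintype n]

theorem trace_mul_nonneg {A B : Matrix n n 𝕜} (hA : 0 ≤ A) (hB : 0 ≤ B) : 0 ≤ (A * B).trace := by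
  obtain ⟨k, v, rfl⟩ := Matrix.posSemidef_iff_eq_sum_vecMulVec.mp
    (Matrix.nonneg_iff_posSemidef.mp hA)
  simp only [Finset.sum_mul, Matrix.trace_sum, Matrix.vecMulVec_mul, Matrix.trace_vecMulVec]
  refine Finset.sum_nonneg fun i _ => ?_
  rw [dotProduct_comm, ← Matrix.dotProduct_mulVec]
  exact (Matrix.nonneg_iff_posSemidef.mp hB).dotProduct_mulVec_nonneg (v i)

theorem trace_mul_le_trace_mul {A B C : Matrix n n 𝕜} (hAB : A ≤ B) (hC : 0 ≤ C) :
    (A * C).trace ≤ (B * C).trace := by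
  rw [← sub_nonneg, ← Matrix.trace_sub, ← sub_mul]
  exact trace_mul_nonneg (sub_nonneg.mpr hAB) hC

theorem isStarProjection_vecMulVec_star {x : n → 𝕜} (hx : star x ⬝ᵥ x = 1) :
    IsStarProjection (Matrix.vecMulVec x (star x)) where
  isIdempotentElem := by
    rw [IsIdempotentElem, Matrix.vecMulVec_mul_vecMulVec, hx, one_smul]
  isSelfAdjoint := (Matrix.posSemidef_vecMulVec_self_star x).isHermitian

theorem nonneg_of_forall_isStarProjection {A : Matrix n n 𝕜} (hA : A.IsHermitian)
    (h : ∀ P : Matrix n n 𝕜, IsStarProjection P → 0 ≤ RCLike.re (P * A).trace) : 0 ≤ A := by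
  classical
  refine (hA.posSemidef_iff_eigenvalues_nonneg.mpr fun i => ?_).nonneg
  set v := hA.eigenvectorBasis i
  have hv : star ⇑v ⬝ᵥ ⇑v = 1 := by
    rw [dotProduct_comm, ← EuclideanSpace.inner_eq_star_dotProduct, inner_self_eq_norm_sq_to_K,
      hA.eigenvectorBasis.orthonormal.1 i]
    simp
  have hP := h _ (isStarProjection_vecMulVec_star hv)
  rwa [Matrix.vecMulVec_mul, Matrix.trace_vecMulVec, dotProduct_comm, ← Matrix.dotProduct_mulVec,
    ← hA.eigenvalues_eq] at hP

end PositiveMatrices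

section RealPart

open scoped ComplexStarModule

variable {n : Type*} [Fintype n]

theorem re_trace_mul_realPart {A : Matrix n n ℂ} (hA : A.IsHermitian) (B : Matrix n n ℂ) :
    (A * (ℜ B : Matrix n n ℂ)).trace.re = (A * B).trace.re := by
  have hstar : (A * star B).trace = star (A * B).trace := by
    rw [Matrix.star_eq_conjTranspose, Matrix.trace_mul_comm, ← Matrix.trace_conjTranspose,
      Matrix.conjTranspose_mul, hA.eq]
  rw [realPart_apply_coe, Matrix.mul_smul, Matrix.trace_smul, mul_add, Matrix.trace_add, hstar,
    Complex.smul_re, Complex.add_re, Complex.star_def, Complex.conj_re, smul_eq_mul]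
  ring

theorem re_trace_mul_compress_one_sub_smul [DecidableEq n] {A M P : Matrix n n ℂ}
    (hA : A.IsHermitian) (hM : M.IsHermitian) (hP : P.IsHermitian) (ε : ℝ) :
    (A * ((1 - ε • P) * M * (1 - ε • P))).trace.re =
      (A * M).trace.re - ε * (2 * (P * (A * M)).trace.re) + ε ^ 2 * (A * (P * M * P)).trace.re := by
  have hAMP : (A * (M * P)).trace = (P * (A * M)).trace := by
    rw [← Matrix.mul_assoc, Matrix.trace_mul_comm]
  have hAPM : (A * (P * M)).trace = star (P * (A * M)).trace := by
    rw [← Matrix.mul_assoc, Matrix.trace_mul_cycle, ← Matrix.trace_conjTranspose,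
      Matrix.conjTranspose_mul, Matrix.conjTranspose_mul, hA.eq, hM.eq, hP.eq]
  simp only [sub_mul, mul_sub, one_mul, mul_one, Matrix.smul_mul, Matrix.mul_smul,
    Matrix.trace_sub, Matrix.trace_smul, hAMP, hAPM, Complex.sub_re, Complex.smul_re,
    Complex.star_def, Complex.conj_re, smul_eq_mul]
  ring

end RealPart

theorem nonneg_of_eventually_nonneg_add_mul {a b : ℝ}
    (h : ∀ᶠ ε in nhdsWithin 0 (Set.Ioi 0), 0 ≤ a + ε * b) : 0 ≤ a := by
  have hlim : Filter.Tendsto (fun ε : ℝ => a + ε * b) (nhdsWithin 0 (Set.Ioi 0)) (nhds a) := by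
    have hcont : Continuous fun ε : ℝ => a + ε * b := by fun_prop
    simpa using (hcont.tendsto 0).mono_left nhdsWithin_le_nhds
  exact ge_of_tendsto hlim h

theorem prod_lt_prod_iff_exists_lt {ι R : Type*} [Fintype ι] [CommMonoidWithZero R] [LinearOrder R]
    [ZeroLEOneClass R] [PosMulStrictMono R] [Nontrivial R] {f g : ι → R} (hf : ∀ i, 0 < f i)
    (hfg : ∀ i, f i ≤ g i) : ∏ i, f i < ∏ i, g i ↔ ∃ i, f i < g i := by
  refine ⟨fun h => ?_, fun ⟨i, hi⟩ => Finset.prod_lt_prod (fun i _ => hf i) (fun i _ => hfg i)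
    ⟨i, Finset.mem_univ i, hi⟩⟩
  by_contra! hgf
  exact h.ne (Finset.prod_congr rfl fun i _ => (hfg i).antisymm (hgf i))

section Measurements

variable {m : ℕ} {D : Fin m → Type} [∀ k, Fintype (D k)] [∀ k, DecidableEq (D k)]
  {ι : Type} [Fintype ι]

theorem isMeasurement_iff {M : ι → Op D} : IsMeasurement M ↔ 0 ≤ M ∧ ∑ i, M i = 1 :=
  ⟨fun h => ⟨fun i => (h.posSemidef i).nonneg, h.sum_eq_one⟩,
    fun h => ⟨fun i => Matrix.nonneg_iff_posSemidef.mp (h.1 i), h.2⟩⟩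

theorem IsMeasurement.nonneg {M : ι → Op D} (hM : IsMeasurement M) (i : ι) : 0 ≤ M i :=
  (hM.posSemidef i).nonneg

theorem IsMeasurement.le_one {M : ι → Op D} (hM : IsMeasurement M) (i : ι) : M i ≤ 1 :=
  (Finset.single_le_sum (fun j _ => hM.nonneg j) (Finset.mem_univ i)).trans_eq hM.sum_eq_one

open scoped Matrix.Norms.L2Operator in
theorem isCompact_setOf_isMeasurement : IsCompact {M : ι → Op D | IsMeasurement M} := by
  have : ProperSpace (ι → Op D) := FiniteDimensional.proper ℂ _
  refine Metric.isCompact_of_isClosed_isBounded ?_ ?_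
  · have hsum : Continuous fun M : ι → Op D => ∑ i, M i := by fun_prop
    simp only [isMeasurement_iff]
    exact isClosed_Ici.inter (isClosed_eq hsum continuous_const)
  · refine (Metric.isBounded_closedBall (x := 0) (r := 1)).subset fun M hM => ?_
    rw [mem_closedBall_zero_iff, pi_norm_le_iff_of_nonneg zero_le_one]
    exact fun i => (CStarAlgebra.norm_le_one_iff_of_nonneg (M i) (hM.nonneg i)).mpr (hM.le_one i)

variable [DecidableEq ι]

theorem isMeasurement_single (i : ι) : IsMeasurement (Pi.single i 1 : ι → Op D) :=
  isMeasurement_iff.mpr ⟨Pi.single_nonneg.mpr zero_le_one, by simp⟩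

theorem isLOCCMeasurement_single (i : ι) : IsLOCCMeasurement (Pi.single i 1 : ι → Op D) :=
  ⟨isMeasurement_single i, 0, i, rfl⟩

/-- The variation of the measurement `M` towards the outcome `j` along the projection `P`: every
effect is compressed by `1 - ε P`, and the missing weight `1 - (1 - ε P)²` goes to `j`. -/
noncomputable def variation (M : ι → Op D) (P : Op D) (j : ι) (ε : ℝ) : ι → Op D :=
  (fun i => (1 - ε • P) * M i * (1 - ε • P)) + Pi.single j ((2 * ε - ε ^ 2) • P)

theorem isMeasurement_variation {M : ι → Op D} (hM : IsMeasurement M) {P : Op D}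
    (hP : IsStarProjection P) (j : ι) {ε : ℝ} (hε : ε ∈ Set.Icc 0 2) :
    IsMeasurement (variation M P j ε) := by
  refine isMeasurement_iff.mpr ⟨add_nonneg (fun i => ?_) ?_, ?_⟩
  · exact ((IsSelfAdjoint.one _).sub (.smul (.all ε) hP.isSelfAdjoint)).conjugate_nonneg
      (hM.nonneg i)
  · exact Pi.single_nonneg.mpr (smul_nonneg (by nlinarith [hε.1, hε.2]) hP.nonneg)
  · have hsq : (1 - ε • P) * (1 - ε • P) = 1 - (2 * ε - ε ^ 2) • P := by
      simp only [mul_sub, sub_mul, mul_one, one_mul, smul_mul_smul_comm, hP.isIdempotentElem.eq]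
      module
    calc ∑ i, variation M P j ε i
        = (1 - ε • P) * (∑ i, M i) * (1 - ε • P) + (2 * ε - ε ^ 2) • P := by
          simp [variation, Finset.sum_add_distrib, Finset.sum_mul, Finset.mul_sum]
      _ = 1 := by rw [hM.sum_eq_one, mul_one, hsq, sub_add_cancel]

end Measurements

namespace Ensemble

variable {m : ℕ} {D : Fin m → Type} [∀ k, Fintype (D k)] {ι : Type} [Fintype ι]

section Success

theorem nonempty_index (E : Ensemble D ι) : Nonempty ι := by
  by_contra! h
  simpa using E.prob_sum

theorem iSup_prob_pos (E : Ensemble D ι) : 0 < ⨆ i, E.prob i := by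
  obtain ⟨i⟩ := E.nonempty_index
  exact (E.prob_pos i).trans_le (le_ciSup (Finite.bddAbove_range _) i)

/-- The subnormalized state `ηᵢ ρᵢ`. -/
noncomputable def weightedState (E : Ensemble D ι) (i : ι) : Op D :=
  E.prob i • E.state i

theorem weightedState_nonneg (E : Ensemble D ι) (i : ι) : 0 ≤ E.weightedState i :=
  smul_nonneg (E.prob_pos i).le (E.state_posSemidef i).nonneg

theorem isHermitian_weightedState (E : Ensemble D ι) (i : ι) : (E.weightedState i).IsHermitian :=
  (Matrix.nonneg_iff_posSemidef.mp (E.weightedState_nonneg i)).isHermitian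

theorem success_eq_sum (E : Ensemble D ι) (M : ι → Op D) :
    E.success M = ∑ i, (E.weightedState i * M i).trace.re := by
  simp [success, weightedState]

theorem success_add (E : Ensemble D ι) (M N : ι → Op D) :
    E.success (M + N) = E.success M + E.success N := by
  simp [success_eq_sum, mul_add, Finset.sum_add_distrib]

theorem success_single [DecidableEq ι] (E : Ensemble D ι) (i : ι) (A : Op D) :
    E.success (Pi.single i A) = (E.weightedState i * A).trace.re := by
  rw [success_eq_sum, Finset.sum_eq_single i (fun j _ hj => by simp [hj]) (by simp),
    Pi.single_eq_same]

theorem continuous_success (E : Ensemble D ι) : Continuous (E.success : (ι → Op D) → ℝ) := by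
  unfold success
  fun_prop

variable [∀ k, DecidableEq (D k)]

theorem success_single_one [DecidableEq ι] (E : Ensemble D ι) (i : ι) :
    E.success (Pi.single i 1) = E.prob i := by
  simp [success_single, weightedState, E.state_trace]

theorem ofReal_success (E : Ensemble D ι) {M : ι → Op D} (hM : IsMeasurement M) :
    (E.success M : ℂ) = ∑ i, (E.weightedState i * M i).trace := by
  rw [success_eq_sum, Complex.ofReal_sum]
  refine Finset.sum_congr rfl fun i _ => ?_
  exact (Complex.eq_re_of_ofReal_le
    (trace_mul_nonneg (E.weightedState_nonneg i) (hM.nonneg i))).symm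

end Success

section OptimalValues

variable [∀ k, DecidableEq (D k)]

theorem exists_isGreatest_success (E : Ensemble D ι) :
    ∃ M, IsMeasurement M ∧
      IsGreatest {p | ∃ M : ι → Op D, IsMeasurement M ∧ p = E.success M} (E.success M) := by
  classical
  obtain ⟨i⟩ := E.nonempty_index
  obtain ⟨M, hM, hmax⟩ := isCompact_setOf_isMeasurement.exists_isMaxOn
    ⟨_, isMeasurement_single i⟩ E.continuous_success.continuousOn
  exact ⟨M, hM, ⟨M, hM, rfl⟩, by rintro _ ⟨N, hN, rfl⟩; exact hmax hN⟩

theorem exists_success_eq_pG (E : Ensemble D ι) : ∃ M, IsMeasurement M ∧ E.success M = E.pG := by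
  obtain ⟨M, hM, hmax⟩ := E.exists_isGreatest_success
  exact ⟨M, hM, hmax.csSup_eq.symm⟩

theorem success_le_pG (E : Ensemble D ι) {M : ι → Op D} (hM : IsMeasurement M) :
    E.success M ≤ E.pG := by
  obtain ⟨_, _, hmax⟩ := E.exists_isGreatest_success
  exact le_csSup hmax.bddAbove ⟨M, hM, rfl⟩

variable [DecidableEq ι]

theorem success_le_pL (E : Ensemble D ι) {M : ι → Op D} (hM : IsLOCCMeasurement M) :
    E.success M ≤ E.pL := by
  refine le_csSup ⟨E.pG, ?_⟩ ⟨M, hM, rfl⟩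
  rintro _ ⟨N, hN, rfl⟩
  exact E.success_le_pG hN.1

theorem pL_le_pG (E : Ensemble D ι) : E.pL ≤ E.pG := by
  obtain ⟨i⟩ := E.nonempty_index
  refine csSup_le ⟨_, _, isLOCCMeasurement_single i, rfl⟩ ?_
  rintro _ ⟨M, hM, rfl⟩
  exact E.success_le_pG hM.1

theorem iSup_prob_le_pL (E : Ensemble D ι) : ⨆ i, E.prob i ≤ E.pL := by
  have := E.nonempty_index
  exact ciSup_le fun i => (E.success_single_one i).symm.trans_le
    (E.success_le_pL (isLOCCMeasurement_single i))

end OptimalValues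

section Duality

open scoped ComplexStarModule

/-- `K` is a feasible point of the semidefinite program dual to minimum-error discrimination,
whose objective is to minimize `Tr K`. -/
def IsDualFeasible (E : Ensemble D ι) (K : Op D) : Prop :=
  ∀ i, E.weightedState i ≤ K

/-- The Lagrange operator `∑ᵢ ηᵢ ρᵢ Mᵢ` of the measurement `M`, symmetrized so that it is Hermitian
for every `M`; at an optimal `M` it solves the dual program. -/
noncomputable def lagrangeOp (E : Ensemble D ι) (M : ι → Op D) : Op D :=
  ℜ (∑ i, E.weightedState i * M i)

theorem isHermitian_lagrangeOp (E : Ensemble D ι) (M : ι → Op D) :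
    (E.lagrangeOp M).IsHermitian :=
  (ℜ (∑ i, E.weightedState i * M i)).2

theorem re_trace_mul_lagrangeOp (E : Ensemble D ι) (M : ι → Op D) {P : Op D}
    (hP : P.IsHermitian) :
    (P * E.lagrangeOp M).trace.re = ∑ i, (P * (E.weightedState i * M i)).trace.re := by
  rw [lagrangeOp, re_trace_mul_realPart hP, Finset.mul_sum, Matrix.trace_sum, Complex.re_sum]

theorem re_trace_lagrangeOp (E : Ensemble D ι) (M : ι → Op D) :
    (E.lagrangeOp M).trace.re = E.success M := by
  classical
  simpa [success_eq_sum] using E.re_trace_mul_lagrangeOp M Matrix.isHermitian_one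

variable [∀ k, DecidableEq (D k)]

theorem IsDualFeasible.pG_le_trace {E : Ensemble D ι} {K : Op D} (hK : E.IsDualFeasible K) :
    (E.pG : ℂ) ≤ K.trace := by
  obtain ⟨M, hM, hMp⟩ := E.exists_success_eq_pG
  calc (E.pG : ℂ) = ∑ i, (E.weightedState i * M i).trace := by rw [← hMp, E.ofReal_success hM]
    _ ≤ ∑ i, (K * M i).trace :=
      Finset.sum_le_sum fun i _ => trace_mul_le_trace_mul (hK i) (hM.nonneg i)
    _ = K.trace := by rw [← Matrix.trace_sum, ← Finset.mul_sum, hM.sum_eq_one, mul_one]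

theorem success_compress_one_sub_smul (E : Ensemble D ι) {M : ι → Op D}
    (hM : ∀ i, (M i).IsHermitian) {P : Op D} (hP : P.IsHermitian) (ε : ℝ) :
    E.success (fun i => (1 - ε • P) * M i * (1 - ε • P)) =
      E.success M - ε * (2 * (P * E.lagrangeOp M).trace.re) +
        ε ^ 2 * E.success fun i => P * M i * P := by
  simp only [success_eq_sum, E.re_trace_mul_lagrangeOp M hP,
    re_trace_mul_compress_one_sub_smul (E.isHermitian_weightedState _) (hM _) hP,
    Finset.sum_add_distrib, Finset.sum_sub_distrib, Finset.mul_sum]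

theorem success_variation [DecidableEq ι] (E : Ensemble D ι) {M : ι → Op D}
    (hM : ∀ i, (M i).IsHermitian) {P : Op D} (hP : P.IsHermitian) (j : ι) (ε : ℝ) :
    E.success (variation M P j ε) = E.success M -
      ε * (2 * (P * (E.lagrangeOp M - E.weightedState j)).trace.re +
        ε * ((P * E.weightedState j).trace.re - E.success fun i => P * M i * P)) := by
  rw [variation, success_add, E.success_compress_one_sub_smul hM hP, success_single,
    Matrix.trace_mul_comm (E.weightedState j), Matrix.smul_mul, Matrix.trace_smul,
    Complex.smul_re, smul_eq_mul, mul_sub, Matrix.trace_sub, Complex.sub_re]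
  ring

theorem isDualFeasible_lagrangeOp (E : Ensemble D ι) {M : ι → Op D} (hM : IsMeasurement M)
    (hopt : E.success M = E.pG) : E.IsDualFeasible (E.lagrangeOp M) := by
  classical
  intro j
  refine sub_nonneg.mp (nonneg_of_forall_isStarProjection
    ((E.isHermitian_lagrangeOp M).sub (E.isHermitian_weightedState j)) fun P hP => ?_)
  suffices hgap : 0 ≤ 2 * (P * (E.lagrangeOp M - E.weightedState j)).trace.re from
    nonneg_of_mul_nonneg_right hgap two_pos
  refine nonneg_of_eventually_nonneg_add_mul
    (b := (P * E.weightedState j).trace.re - E.success fun i => P * M i * P) ?_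
  filter_upwards [Ioc_mem_nhdsGT two_pos] with ε hε
  have hle := E.success_le_pG (isMeasurement_variation hM hP j (Set.Ioc_subset_Icc_self hε))
  rw [E.success_variation (fun i => (hM.posSemidef i).isHermitian) hP.isSelfAdjoint, hopt,
    sub_le_self_iff] at hle
  exact nonneg_of_mul_nonneg_right hle hε.1

theorem exists_isDualFeasible_trace_eq_pG (E : Ensemble D ι) :
    ∃ K, E.IsDualFeasible K ∧ K.trace = E.pG := by
  obtain ⟨M, hM, hopt⟩ := E.exists_success_eq_pG
  have hK := E.isDualFeasible_lagrangeOp hM hopt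
  refine ⟨E.lagrangeOp M, hK, ?_⟩
  rw [Complex.eq_re_of_ofReal_le hK.pG_le_trace, re_trace_lagrangeOp, hopt]

end Duality

end Ensemble

section Sequences

variable {L m : ℕ} {D : Fin L → Fin m → Type}

theorem sum_seqOp {ι : Fin L → Type*} [∀ l, Fintype (ι l)] (A : ∀ l, ι l → Op (D l)) :
    ∑ c : ∀ l, ι l, seqOp (fun l => A l (c l)) = seqOp fun l => ∑ i, A l i := by
  ext a b
  simp only [seqOp, Matrix.sum_apply, Fintype.prod_sum]

theorem seqOp_one [∀ l k, DecidableEq (D l k)] : seqOp (fun l => (1 : Op (D l))) = 1 := by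
  ext a b
  have hswap : (∀ l, (fun k => a k l) = fun k => b k l) ↔ a = b := by
    simp only [funext_iff]
    exact forall_comm
  simp [seqOp, Matrix.one_apply, Finset.prod_ite_zero, hswap]

theorem seqOp_smul (r : Fin L → ℝ) (A : ∀ l, Op (D l)) :
    seqOp (fun l => r l • A l) = (∏ l, r l) • seqOp A := by
  ext a b
  simp [seqOp, Finset.prod_mul_distrib]

theorem seqOp_nonneg [∀ l k, Finite (D l k)] {A : ∀ l, Op (D l)} (hA : ∀ l, 0 ≤ A l) :
    0 ≤ seqOp A := by
  have := fun l k => Fintype.ofFinite (D l k)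
  exact (seqOp_posSemidef fun l => Matrix.nonneg_iff_posSemidef.mp (hA l)).nonneg

theorem seqOp_mono [∀ l k, Finite (D l k)] {A B : ∀ l, Op (D l)} (hA : ∀ l, 0 ≤ A l)
    (hAB : ∀ l, A l ≤ B l) : seqOp A ≤ seqOp B := by
  -- Expand `⨂ₗ (Aₗ + (Bₗ - Aₗ))` into `2 ^ L` nonnegative terms, one of which is `⨂ₗ Aₗ`.
  let term : ∀ l, Bool → Op (D l) := fun l s => bif s then A l else B l - A l
  have hterm : ∀ l s, 0 ≤ term l s := fun l s => by
    cases s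
    exacts [sub_nonneg.mpr (hAB l), hA l]
  calc seqOp A = seqOp fun l => term l true := rfl
    _ ≤ ∑ c : Fin L → Bool, seqOp fun l => term l (c l) :=
      Finset.single_le_sum (f := fun c : Fin L → Bool => seqOp fun l => term l (c l))
        (fun c _ => seqOp_nonneg fun l => hterm l (c l)) (Finset.mem_univ fun _ => true)
    _ = seqOp B := by
      rw [sum_seqOp term]
      simp [term]

variable [∀ l k, Fintype (D l k)]

theorem seqOp_mul (A B : ∀ l, Op (D l)) : seqOp A * seqOp B = seqOp fun l => A l * B l := by
  ext a b
  simp only [seqOp, Matrix.mul_apply, ← Finset.prod_mul_distrib, Fintype.prod_sum]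
  exact ((Equiv.piComm fun l k => D l k).sum_comp _).symm

variable {n : Fin L → ℕ}

theorem weightedState_seqEnsemble (E : ∀ l, Ensemble (D l) (Fin (n l))) (c : ∀ l, Fin (n l)) :
    (seqEnsemble E).weightedState c = seqOp fun l => (E l).weightedState (c l) :=
  (seqOp_smul _ _).symm

theorem Ensemble.IsDualFeasible.seqOp {E : ∀ l, Ensemble (D l) (Fin (n l))} {K : ∀ l, Op (D l)}
    (hK : ∀ l, (E l).IsDualFeasible (K l)) : (seqEnsemble E).IsDualFeasible (seqOp K) := fun c => by
  rw [weightedState_seqEnsemble]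
  exact seqOp_mono (fun l => (E l).weightedState_nonneg (c l)) fun l => hK l (c l)

theorem iSup_prob_seqEnsemble (E : ∀ l, Ensemble (D l) (Fin (n l))) :
    ⨆ c, (seqEnsemble E).prob c = ∏ l, ⨆ i, (E l).prob i := by
  have := fun l => (E l).nonempty_index
  apply le_antisymm
  · exact ciSup_le fun c => Finset.prod_le_prod (s := Finset.univ)
      (fun l _ => ((E l).prob_pos (c l)).le) fun l _ => le_ciSup (Finite.bddAbove_range _) (c l)
  · choose c hc using fun l => exists_eq_ciSup_of_finite (f := (E l).prob)
    simp only [← hc]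
    exact le_ciSup (f := (seqEnsemble E).prob) (Finite.bddAbove_range _) c

variable [∀ l k, DecidableEq (D l k)]

theorem isMeasurement_seqOp {ι : Fin L → Type} [∀ l, Fintype (ι l)] {M : ∀ l, ι l → Op (D l)}
    (hM : ∀ l, IsMeasurement (M l)) :
    IsMeasurement fun c : ∀ l, ι l => seqOp fun l => M l (c l) where
  posSemidef c := seqOp_posSemidef fun l => (hM l).posSemidef (c l)
  sum_eq_one := by simp only [sum_seqOp, (hM _).sum_eq_one, seqOp_one]

theorem success_seqEnsemble (E : ∀ l, Ensemble (D l) (Fin (n l)))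
    {M : ∀ l, Fin (n l) → Op (D l)} (hM : ∀ l, IsMeasurement (M l)) :
    (seqEnsemble E).success (fun c => seqOp fun l => M l (c l)) = ∏ l, (E l).success (M l) := by
  apply Complex.ofReal_injective
  rw [Ensemble.ofReal_success _ (isMeasurement_seqOp hM), Complex.ofReal_prod]
  simp only [(E _).ofReal_success (hM _), Fintype.prod_sum, weightedState_seqEnsemble, seqOp_mul,
    seqOp_trace]

theorem prod_pG_le_pG_seqEnsemble (E : ∀ l, Ensemble (D l) (Fin (n l))) :
    ∏ l, (E l).pG ≤ (seqEnsemble E).pG := by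
  choose M hM hMp using fun l => (E l).exists_success_eq_pG
  simp only [← hMp, ← success_seqEnsemble E hM]
  exact (seqEnsemble E).success_le_pG (isMeasurement_seqOp hM)

theorem pG_seqEnsemble_le_prod_pG (E : ∀ l, Ensemble (D l) (Fin (n l))) :
    (seqEnsemble E).pG ≤ ∏ l, (E l).pG := by
  choose K hK hKp using fun l => (E l).exists_isDualFeasible_trace_eq_pG
  have hle := (Ensemble.IsDualFeasible.seqOp hK).pG_le_trace
  simp only [seqOp_trace, hKp, ← Complex.ofReal_prod] at hle
  exact Complex.real_le_real.mp hle

theorem pG_seqEnsemble (E : ∀ l, Ensemble (D l) (Fin (n l))) :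
    (seqEnsemble E).pG = ∏ l, (E l).pG :=
  (pG_seqEnsemble_le_prod_pG E).antisymm (prod_pG_le_pG_seqEnsemble E)

end Sequences

end QuantumSequence

open QuantumSequence in
theorem corollary2_general {L m : ℕ} (D : Fin L → Fin m → Type) [∀ l k, Fintype (D l k)]
    [∀ l k, DecidableEq (D l k)] (n : Fin L → ℕ) (E : ∀ l, Ensemble (D l) (Fin (n l)))
    (hE : IsFactorizable E) :
    ((⨆ c, (seqEnsemble E).prob c) < (seqEnsemble E).pL ∧
      (seqEnsemble E).pL < (seqEnsemble E).pG) ↔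
    ∃ l l' : Fin L, (⨆ i, (E l).prob i) < (E l).pL ∧ (E l').pL < (E l').pG := by
  have hpos := fun l => (E l).iSup_prob_pos
  have hL := fun l => (E l).iSup_prob_le_pL
  have hLG := fun l => (E l).pL_le_pG
  rw [IsFactorizable] at hE
  rw [hE, iSup_prob_seqEnsemble, pG_seqEnsemble, prod_lt_prod_iff_exists_lt hpos hL,
    prod_lt_prod_iff_exists_lt (fun l => (hpos l).trans_le (hL l)) hLG]
  simp only [exists_and_left, exists_and_right]

theorem corollary2 {L m : ℕ} (d : Fin L → Fin m → ℕ) (n : Fin L → ℕ)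
    (E : ∀ l, QuantumSequence.Ensemble (fun k => Fin (d l k)) (Fin (n l)))
    (hE : QuantumSequence.IsFactorizable E) :
    ((⨆ c, (QuantumSequence.seqEnsemble E).prob c) < (QuantumSequence.seqEnsemble E).pL ∧
      (QuantumSequence.seqEnsemble E).pL < (QuantumSequence.seqEnsemble E).pG) ↔
    ∃ l l' : Fin L, (⨆ i, (E l).prob i) < (E l).pL ∧ (E l').pL < (E l').pG :=
  corollary2_general _ n E hE
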